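/- Let $\mathbb{K}$ be an algebraically closed field of characteristic $0$, let $p\in\mathbb{K}[x,y]\setminus(\mathbb{K}[x]\cup\mathbb{K}[y])$ be irreducible, and let $C\subset\mathbb{P}^1(\mathbb{K})\times\mathbb{P}^1(\mathbb{K})$ be the curve defined by the bi-homogenization $x_0^{\deg_x p}y_0^{\deg_y p}\,p(x_1/x_0,y_1/y_0)$ of $p$, where $\mathbb{P}^1(\mathbb{K})=\mathbb{K}\cup\{\infty\}$. The orbit of a point of $C$ is its equivalence class under the smallest equivalence relation $\sim$ on $C$ such that $(a,b)\sim(c,d)$ whenever $a=c$ or $b=d$. Let $r\in\mathbb{K}(x,y)$ be a rational function whose denominator (in reduced form) is not divisible by $p$. A point $(s_1,s_2)\in C$ is called a pole of $r$ if there are Möbius transformations $T_1,T_2$ of $\mathbb{P}^1(\mathbb{K})$ with $T_1(s_1)=\infty$ and $T_2(s_2)=\infty$ and a Puiseux series $\varphi$ in $x^{-1}$ over $\mathbb{K}$ such that, with $T=(T_1,T_2)$, $$\deg\varphi>0,\qquad (p\circ T^{-1})(x,\varphi)=0\qquad\text{and}\qquad \deg\,(r\circ T^{-1})(x,\varphi)>0,$$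 where $\deg$ denotes the largest exponent of $x$ occurring in a series. Let $f\in\mathbb{K}(x)$ and $g\in\mathbb{K}(y)$ be such that $f-g=r+qp$ for some $q\in\mathbb{K}(x,y)$ whose denominator is not divisible by $p$. Let $\mathcal{O}\subseteq C$ be an infinite orbit, and assume that there is an $(s_1,s_2)\in\mathcal{O}$ such that $s_1$ is a pole of $f$ or $s_2$ is a pole of $g$ (as rational functions on $\mathbb{P}^1(\mathbb{K})$, so $\infty$ is allowed). Then $\mathcal{O}$ contains a pole of $r$. -/

import Mathlib

open Polynomial

namespace SeparatedVariables

noncomputable section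

/-- The field `𝕂(x, y)` of rational functions in two variables. An element of
`Polynomial (Polynomial 𝕂)` is a polynomial in `y` whose coefficients are polynomials in `x`. -/
abbrev RatFunc₂ (K : Type*) [Field K] : Type _ := FractionRing (Polynomial (Polynomial K))

section Field

variable {K : Type*} [Field K]

/-- The numerator of a rational function in reduced form. -/
def num₂ (r : RatFunc₂ K) : Polynomial (Polynomial K) :=
  IsFractionRing.num (Polynomial (Polynomial K)) r

/-- The denominator of a rational function in reduced form. -/
def den₂ (r : RatFunc₂ K) : Polynomial (Polynomial K) :=
  (IsFractionRing.den (Polynomial (Polynomial K)) r : Polynomial (Polynomial K))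

/-- The inclusion `𝕂(x) ⊆ 𝕂(x, y)`. -/
def inX (f : RatFunc K) : RatFunc₂ K :=
  RatFunc.eval (algebraMap K (RatFunc₂ K)) (algebraMap (Polynomial (Polynomial K)) _ (C X)) f

/-- The inclusion `𝕂(y) ⊆ 𝕂(x, y)`. -/
def inY (g : RatFunc K) : RatFunc₂ K :=
  RatFunc.eval (algebraMap K (RatFunc₂ K)) (algebraMap (Polynomial (Polynomial K)) _ X) g

/-- `𝕂[x, y]_p`: the rational functions whose denominator is not divisible by `p`. -/
def localRing (p : Polynomial (Polynomial K)) : Set (RatFunc₂ K) := {h | ¬ p ∣ den₂ h}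

/-- `⟨p⟩`: the ideal of `𝕂[x, y]_p` generated by `p`. -/
def localIdeal (p : Polynomial (Polynomial K)) : Set (RatFunc₂ K) :=
  {h | ∃ q ∈ localRing p, h = q * algebraMap (Polynomial (Polynomial K)) (RatFunc₂ K) p}

/-- `F(r, p)`: the pairs `(f, g) ∈ 𝕂(x) × 𝕂(y)` with `f - g ∈ r + ⟨p⟩`. -/
def separatedPairs (r : RatFunc₂ K) (p : Polynomial (Polynomial K)) :
    Set (RatFunc K × RatFunc K) :=
  {fg | ∃ h ∈ localIdeal p, inX fg.1 - inY fg.2 = r + h}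

/-- `s ∈ 𝕂 ∪ {∞}` is a pole of the univariate rational function `f`. -/
def IsPole (f : RatFunc K) (s : OnePoint K) : Prop :=
  s.elim (f.denom.natDegree < f.num.natDegree) (fun a => f.denom.eval a = 0)

/-- The homogeneous coordinates `(x₀, x₁)` of a point of `ℙ¹(𝕂) = 𝕂 ∪ {∞}`; the affine coordinate
is `x₁ / x₀`. -/
def homCoord (s : OnePoint K) : K × K := s.elim (0, 1) (fun a => (1, a))

/-- The degree of `p` in `x`. -/
def degX (p : Polynomial (Polynomial K)) : ℕ := (Polynomial.Bivariate.swap p).natDegree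

/-- The degree of `p` in `y`. -/
def degY (p : Polynomial (Polynomial K)) : ℕ := p.natDegree

/-- The bi-homogenization `x₀ ^ deg_x p * y₀ ^ deg_y p * p(x₁ / x₀, y₁ / y₀)`, evaluated at
`u = (x₀, x₁)` and `v = (y₀, y₁)`. -/
def biHomEval (p : Polynomial (Polynomial K)) (u v : K × K) : K :=
  ∑ i ∈ Finset.range (degX p + 1), ∑ j ∈ Finset.range (degY p + 1),
    (p.coeff j).coeff i * (u.2 ^ i * u.1 ^ (degX p - i)) * (v.2 ^ j * v.1 ^ (degY p - j))

/-- The curve in `ℙ¹(𝕂) × ℙ¹(𝕂)` defined by the bi-homogenization of `p`. -/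
def curve (p : Polynomial (Polynomial K)) : Set (OnePoint K × OnePoint K) :=
  {s | biHomEval p (homCoord s.1) (homCoord s.2) = 0}

/-- The smallest equivalence relation on the curve relating any two points that share their first
or their second coordinate. -/
def orbitRel (p : Polynomial (Polynomial K)) : curve p → curve p → Prop :=
  Relation.EqvGen fun s t => s.1.1 = t.1.1 ∨ s.1.2 = t.1.2

/-- The orbit of a point on the curve. -/
def orbit (p : Polynomial (Polynomial K)) (s : curve p) : Set (curve p) := {t | orbitRel p s t}

/-- The value `r(u, v)` of a rational function at elements `u`, `v` of an extension field. -/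
def evalRat {L : Type*} [Field L] [Algebra K L] (u v : L) (r : RatFunc₂ K) : L :=
  aevalAeval u v (num₂ r) / aevalAeval u v (den₂ r)

/-- The Möbius transformation `z ↦ (a z + b) / (c z + d)` on an extension field of `𝕂`. -/
def mobius {L : Type*} [Field L] [Algebra K L] (T : GL (Fin 2) K) (z : L) : L :=
  (algebraMap K L (T 0 0) * z + algebraMap K L (T 0 1)) /
    (algebraMap K L (T 1 0) * z + algebraMap K L (T 1 1))

/-- A Hahn series with rational exponents is a Puiseux series if its exponents have a common
denominator. -/
def IsPuiseux (φ : HahnSeries ℚ K) : Prop :=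
  ∃ n : ℕ, 0 < n ∧ ∀ α ∈ φ.support, ∃ m : ℤ, α * n = m

/-- The element `x` of `𝕂{{x⁻¹}}`. Series in `𝕂{{x⁻¹}}` are written in the variable `x⁻¹`, so that
the coefficient of `x ^ α` sits at the exponent `-α`. -/
def seriesX : HahnSeries ℚ K := HahnSeries.single (-1) 1

/-- The degree in `x` of a series in `𝕂{{x⁻¹}}`, i.e. the largest `α` such that `x ^ α` occurs in
it, with the convention that the zero series has degree `-∞`. -/
def deg (φ : HahnSeries ℚ K) : WithBot ℚ :=
  open Classical in if φ = 0 then ⊥ else ((-φ.order : ℚ) : WithBot ℚ)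

open Classical in
/-- The point `s` on the curve of `p` is a pole of `r`: there is a transformation `T = (T₁, T₂)` of
`ℙ¹(𝕂) × ℙ¹(𝕂)` that maps `s` to `(∞, ∞)` and a Puiseux series `φ ∈ 𝕂{{x⁻¹}}` of positive degree
such that `(p ∘ T⁻¹)(x, φ) = 0` and `deg (r ∘ T⁻¹)(x, φ) > 0`. Here `(h ∘ T⁻¹)(x, φ)` is
`h(T₁⁻¹(x), T₂⁻¹(φ))`. -/
def IsCurvePole (p : Polynomial (Polynomial K)) (r : RatFunc₂ K) (s : curve p) : Prop :=
  ∃ T₁ T₂ : GL (Fin 2) K, T₁ • s.1.1 = OnePoint.infty ∧ T₂ • s.1.2 = OnePoint.infty ∧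
    ∃ φ : HahnSeries ℚ K, IsPuiseux φ ∧ 0 < deg φ ∧
      aevalAeval (mobius T₁⁻¹ seriesX) (mobius T₂⁻¹ φ) p = 0 ∧
      0 < deg (evalRat (mobius T₁⁻¹ seriesX) (mobius T₂⁻¹ φ) r)

end Field

end

end SeparatedVariables

/-!
By the Newton–Puiseux theorem, every point `t = (t₁, t₂)` of the curve is the centre of a place
given by a Puiseux parametrization `(x, y)` with `p(x, y) = 0`. Along it `f(x) - g(y) = r(x, y)`,
and `f(x)`, respectively `g(y)`, has negative order exactly if `f` has a pole at `t₁`, respectively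
`g` has a pole at `t₂`. Hence, if `t` is not a pole of `r`, then `f` has a pole at `t₁` if and only
if `g` has one at `t₂`. In an orbit without poles of `r` this property therefore passes from one
point to all the others, so the orbit lies in the finite set of pairs of a pole of `f` and a pole
of `g`.
-/

namespace SeparatedVariables

noncomputable section

open scoped PowerSeries

universe u
section Weierstrass

open IsLocalRing

theorem order_coe_eq_natTrailingDegree {R : Type*} [Semiring R] {P : R[X]} (hP : P ≠ 0) :
    (P : R⟦X⟧).order = P.natTrailingDegree := by
  rw [PowerSeries.order_eq_nat]
  simp only [coeff_coe]
  exact ⟨coeff_natTrailingDegree_ne_zero.mpr hP, fun _ => coeff_eq_zero_of_lt_natTrailingDegree⟩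

theorem exists_isDistinguishedAt_dvd {A : Type*} [CommRing A] [IsLocalRing A]
    [IsAdicComplete (maximalIdeal A) A] {F : A[X]} (hF : F.map (residue A) ≠ 0) :
    ∃ g : A[X], g.IsDistinguishedAt (maximalIdeal A) ∧ g ∣ F ∧
      g.natDegree = (F.map (residue A)).natTrailingDegree := by
  have hF' : (F : A⟦X⟧).map (residue A) ≠ 0 := by
    rwa [← polynomial_map_coe, Ne, coe_eq_zero_iff]
  obtain ⟨g, h, H⟩ := PowerSeries.exists_isWeierstrassFactorization hF'
  refine ⟨g, H.isDistinguishedAt, ?_, ?_⟩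
  · have hF₀ : H.algEquivQuotient (Ideal.Quotient.mk _ F) = 0 := by
      simp
    rwa [EmbeddingLike.map_eq_zero_iff, Ideal.Quotient.eq_zero_iff_dvd] at hF₀
  · rw [H.natDegree_eq_toNat_order_map, ← polynomial_map_coe,
      order_coe_eq_natTrailingDegree hF, ENat.toNat_natCast]

theorem exists_monic_dvd_map_residue_eq {A : Type*} [CommRing A] [IsLocalRing A]
    [IsAdicComplete (maximalIdeal A) A] {F : A[X]} (hF : F.map (residue A) ≠ 0) (a : A) :
    ∃ g : A[X], g.Monic ∧ g ∣ F ∧ g.map (residue A) =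
      (X - C (residue A a)) ^ (F.map (residue A)).rootMultiplicity (residue A a) := by
  have htaylor : (taylor a F).map (residue A) = taylor (residue A a) (F.map (residue A)) := by
    rw [map_taylor]
  obtain ⟨g, hg, hgF, hdeg⟩ := exists_isDistinguishedAt_dvd (F := taylor a F)
    (by rwa [htaylor, Ne, taylor_eq_zero])
  refine ⟨taylor (-a) g, by rw [Monic, leadingCoeff_taylor, hg.monic], ?_, ?_⟩
  · have := map_dvd (taylorAlgHom (-a)) hgF
    simpa [taylor_taylor] using this
  · rw [map_taylor, show g.map (residue A) = X ^ g.natDegree from hg.map_eq_X_pow, hdeg, htaylor,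
      rootMultiplicity_eq_natTrailingDegree, ← taylor_apply, taylor_pow, taylor_X, map_neg, C_neg,
      sub_eq_add_neg]

theorem exists_monic_dvd_map_eq {A k : Type*} [CommRing A] [IsLocalRing A]
    [IsAdicComplete (maximalIdeal A) A] [Field k] {φ : A →+* k} (hφ : Function.Surjective φ)
    {F : A[X]} (hF : F.map φ ≠ 0) (e : k) :
    ∃ g : A[X], g.Monic ∧ g ∣ F ∧ g.map φ = (X - C e) ^ (F.map φ).rootMultiplicity e := by
  obtain ⟨a, rfl⟩ := hφ e
  have : IsLocalHom φ := .of_surjective φ hφ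
  set ι : ResidueField A →+* k := ResidueField.lift φ
  have hmap (P : A[X]) : P.map φ = (P.map (residue A)).map ι := by
    rw [map_map, ResidueField.lift_comp_residue]
  have hφa : φ a = ι (residue A a) := (ResidueField.lift_residue_apply φ a).symm
  rw [hmap, Ne, Polynomial.map_eq_zero] at hF
  obtain ⟨g, hg, hgF, hgmap⟩ := exists_monic_dvd_map_residue_eq hF a
  refine ⟨g, hg, hgF, ?_⟩
  rw [hmap g, hgmap, hmap F, hφa, ← eq_rootMultiplicity_map ι.injective, Polynomial.map_pow,
    Polynomial.map_sub, map_X, map_C]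

end Weierstrass

theorem nextCoeff_taylor {R : Type*} [CommSemiring R] (c : R) (F : R[X]) :
    (taylor c F).nextCoeff = F.nextCoeff + F.natDegree * F.leadingCoeff * c := by
  rcases Nat.eq_zero_or_pos F.natDegree with h0 | hpos
  · simp [nextCoeff, natDegree_taylor, h0]
  have hD : (hasseDeriv (F.natDegree - 1) F).natDegree ≤ 1 :=
    (natDegree_hasseDeriv_le _ _).trans (by omega)
  have hidx : 1 + (F.natDegree - 1) = F.natDegree := by omega
  have hchoose : F.natDegree.choose (F.natDegree - 1) = F.natDegree := by
    rw [Nat.choose_symm (by omega : 1 ≤ F.natDegree), Nat.choose_one_right]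
  rw [nextCoeff_of_natDegree_pos (by rwa [natDegree_taylor]), natDegree_taylor, taylor_coeff,
    eq_X_add_C_of_natDegree_le_one hD, nextCoeff_of_natDegree_pos hpos]
  simp only [eval_add, eval_mul, eval_C, eval_X, hasseDeriv_coeff, hidx, hchoose, coeff_natDegree,
    zero_add, Nat.choose_self, Nat.cast_one, one_mul]
  ring

theorem exists_nextCoeff_taylor_eq_zero {R : Type*} [CommRing R] {F : R[X]} (hF : F.Monic)
    (hn : IsUnit (F.natDegree : R)) : ∃ c, (taylor c F).nextCoeff = 0 := by
  obtain ⟨u, hu⟩ := hn.exists_right_inv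
  refine ⟨-(u * F.nextCoeff), ?_⟩
  rw [nextCoeff_taylor, hF.leadingCoeff]
  linear_combination -F.nextCoeff * hu

theorem nextCoeff_scaleRoots {R : Type*} [CommSemiring R] (F : R[X]) (s : R) :
    (F.scaleRoots s).nextCoeff = F.nextCoeff * s := by
  rcases Nat.eq_zero_or_pos F.natDegree with h0 | hpos
  · simp [nextCoeff, natDegree_scaleRoots, h0]
  rw [nextCoeff_of_natDegree_pos (by rwa [natDegree_scaleRoots]), natDegree_scaleRoots,
    coeff_scaleRoots, Nat.sub_sub_self hpos, pow_one, nextCoeff_of_natDegree_pos hpos]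

theorem exists_scaleRoots_eq {R : Type*} [CommSemiring R] {F : R[X]} {s : R}
    (h : ∀ i < F.natDegree, s ^ (F.natDegree - i) ∣ F.coeff i) :
    ∃ G : R[X], G.scaleRoots s = F := by
  have hdvd (i : ℕ) : s ^ (F.natDegree - i) ∣ F.coeff i := by
    rcases lt_or_ge i F.natDegree with hi | hi
    · exact h i hi
    · simp [Nat.sub_eq_zero_of_le hi]
  choose q hq using hdvd
  set G : R[X] := ∑ i ∈ Finset.range (F.natDegree + 1), monomial i (q i)
  have hG (i : ℕ) : G.coeff i = if i ≤ F.natDegree then q i else 0 := by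
    simp [G, coeff_monomial]
  have hlead : q F.natDegree = F.leadingCoeff := by simpa using (hq F.natDegree).symm
  have hdeg : G.natDegree = F.natDegree := by
    have hle : G.natDegree ≤ F.natDegree :=
      natDegree_le_iff_coeff_eq_zero.mpr fun i hi => by rw [hG, if_neg hi.not_ge]
    rcases eq_or_ne F 0 with rfl | hF
    · simpa using hle
    · exact natDegree_eq_of_le_of_coeff_ne_zero hle (by simpa [hG, hlead] using hF)
  refine ⟨G, ext fun i => ?_⟩
  rw [coeff_scaleRoots, hdeg, hG]
  split_ifs with hi
  · rw [mul_comm, ← hq]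
  · rw [zero_mul, coeff_eq_zero_of_natDegree_lt (not_le.mp hi)]

theorem X_pow_dvd_iff_le_order {R : Type*} [Semiring R] {φ : R⟦X⟧} {m : ℕ} :
    PowerSeries.X ^ m ∣ φ ↔ (m : ℕ∞) ≤ φ.order :=
  PowerSeries.X_pow_dvd_iff.trans ⟨fun h => PowerSeries.nat_le_order _ _ h,
    fun h _ hi => PowerSeries.coeff_of_lt_order _ (lt_of_lt_of_le (mod_cast hi) h)⟩

theorem X_pow_dvd_expand_iff {R : Type*} [CommRing R] {b : ℕ} (hb : b ≠ 0) {φ : R⟦X⟧} (hφ : φ ≠ 0)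
    {m : ℕ} : PowerSeries.X ^ m ∣ PowerSeries.expand b hb φ ↔ m ≤ b * φ.order.toNat := by
  rw [X_pow_dvd_iff_le_order, PowerSeries.order_expand, ← PowerSeries.coe_toNat_order hφ,
    nsmul_eq_mul]
  norm_cast

/-- Here `a / b` is the slope of the first edge of the Newton polygon of
`c₀ + ⋯ + cₙ₋₁ Yⁿ⁻¹ + Yⁿ`. -/
theorem exists_newton_slope {R : Type*} [CommRing R] {c : ℕ → R⟦X⟧} {n : ℕ}
    (hc : ∃ i < n, c i ≠ 0) :
    ∃ (a b : ℕ) (hb : b ≠ 0),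
      (∀ i < n, PowerSeries.X ^ (a * (n - i)) ∣ PowerSeries.expand b hb (c i)) ∧
      ∃ i < n, ¬ PowerSeries.X ^ (a * (n - i) + 1) ∣ PowerSeries.expand b hb (c i) := by
  classical
  obtain ⟨j, hj, hmin⟩ := ((Finset.range n).filter fun i => c i ≠ 0).exists_min_image
    (fun i => ((c i).order.toNat : ℚ) / (n - i : ℕ)) (by simpa [Finset.Nonempty] using hc)
  simp only [Finset.mem_filter, Finset.mem_range, and_imp] at hj hmin
  have hjn : n - j ≠ 0 := by omega
  refine ⟨(c j).order.toNat, n - j, hjn, fun i hi => ?_, j, hj.1, ?_⟩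
  · rcases eq_or_ne (c i) 0 with h0 | h0
    · simp [h0]
    have hij := hmin i hi h0
    rw [div_le_div_iff₀ (by simpa using hj.1) (by simpa using hi)] at hij
    rw [X_pow_dvd_expand_iff hjn h0, mul_comm (n - j)]
    exact_mod_cast hij
  · rw [X_pow_dvd_expand_iff hjn hj.2, mul_comm (n - j)]
    exact Nat.not_succ_le_self _

theorem exists_isRoot_rootMultiplicity_lt_natDegree {K : Type*} [Field K] [IsAlgClosed K]
    [CharZero K] {P : K[X]} (hP : P.Monic) (hnext : P.nextCoeff = 0)
    (hX : P ≠ X ^ P.natDegree) :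
    ∃ e, P.IsRoot e ∧ P.rootMultiplicity e < P.natDegree := by
  have hn : P.natDegree ≠ 0 := fun hn => hX (by rw [hn, pow_zero, hP.natDegree_eq_zero.mp hn])
  obtain ⟨e, he⟩ := IsAlgClosed.exists_root P (by rwa [degree_eq_natDegree hP.ne_zero, Ne,
    Nat.cast_eq_zero])
  refine ⟨e, he, lt_of_not_ge fun hle => hX ?_⟩
  have hpow : P = (X - C e) ^ P.natDegree :=
    eq_of_monic_of_dvd_of_natDegree_le ((monic_X_sub_C e).pow _) hP
      ((le_rootMultiplicity_iff hP.ne_zero).mp hle) (by simp)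
  have he0 : e = 0 := by
    rw [hpow, (monic_X_sub_C e).nextCoeff_pow, nextCoeff_X_sub_C] at hnext
    simpa [hn] using hnext
  rwa [he0, C_0, sub_zero] at hpow

section NewtonPuiseux

variable {K : Type*} [Field K]

theorem exists_monic_dvd_map_constantCoeff_eq {F : K⟦X⟧[X]}
    (hF : F.map PowerSeries.constantCoeff ≠ 0) (e : K) :
    ∃ g : K⟦X⟧[X], g.Monic ∧ g ∣ F ∧
      g.natDegree = (F.map PowerSeries.constantCoeff).rootMultiplicity e ∧
      g.map PowerSeries.constantCoeff = (X - C e) ^ g.natDegree := by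
  have : IsAdicComplete (IsLocalRing.maximalIdeal K⟦X⟧) K⟦X⟧ := by
    rw [PowerSeries.maximalIdeal_eq_span_X]
    infer_instance
  obtain ⟨g, hg, hgF, hmap⟩ := exists_monic_dvd_map_eq PowerSeries.constantCoeff_surj hF e
  have hdeg : g.natDegree = (F.map PowerSeries.constantCoeff).rootMultiplicity e := by
    rw [← hg.natDegree_map PowerSeries.constantCoeff, hmap, natDegree_pow, natDegree_X_sub_C,
      mul_one]
  exact ⟨g, hg, hgF, hdeg, hdeg ▸ hmap⟩

/-- Some root of `F` is a power series in some `x ^ (1 / N)`, written here as a power series `ψ` in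
the uniformizer `x ^ (1 / N)` at which `F`, after the substitution of its `N`-th power for `x`,
vanishes. -/
def HasPuiseuxRoot (F : K⟦X⟧[X]) : Prop :=
  ∃ (N : ℕ) (hN : N ≠ 0) (ψ : K⟦X⟧),
    F.eval₂ (PowerSeries.expand N hN : K⟦X⟧ →ₐ[K] K⟦X⟧).toRingHom ψ = 0

namespace HasPuiseuxRoot

variable {F G : K⟦X⟧[X]}

theorem of_dvd (hG : HasPuiseuxRoot G) (h : G ∣ F) : HasPuiseuxRoot F :=
  let ⟨N, hN, ψ, hψ⟩ := hG
  ⟨N, hN, ψ, eval₂_eq_zero_of_dvd_of_eval₂_eq_zero _ _ h hψ⟩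

theorem of_taylor {c : K⟦X⟧} (h : HasPuiseuxRoot (taylor c F)) : HasPuiseuxRoot F := by
  obtain ⟨N, hN, ψ, hψ⟩ := h
  rw [taylor_apply, eval₂_comp] at hψ
  exact ⟨N, hN, _, hψ⟩

theorem scaleRoots (h : HasPuiseuxRoot F) (s : K⟦X⟧) : HasPuiseuxRoot (F.scaleRoots s) :=
  let ⟨N, hN, _, hψ⟩ := h
  ⟨N, hN, _, scaleRoots_eval₂_eq_zero _ hψ⟩

theorem of_map_expand {b : ℕ} {hb : b ≠ 0}
    (h : HasPuiseuxRoot (F.map (PowerSeries.expand b hb).toRingHom)) : HasPuiseuxRoot F := by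
  obtain ⟨N, hN, ψ, hψ⟩ := h
  refine ⟨N * b, mul_ne_zero hN hb, ψ, ?_⟩
  rw [eval₂_map] at hψ
  rwa [PowerSeries.expand_mul_eq_comp N hN b hb]

end HasPuiseuxRoot

theorem exists_map_expand_eq_scaleRoots {F : K⟦X⟧[X]} (hF : F.Monic) (hX : F ≠ X ^ F.natDegree) :
    ∃ (b : ℕ) (hb : b ≠ 0) (s : K⟦X⟧) (G : K⟦X⟧[X]), s ≠ 0 ∧
      G.scaleRoots s = F.map (PowerSeries.expand b hb).toRingHom ∧
      G.map PowerSeries.constantCoeff ≠ X ^ G.natDegree := by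
  have hne : ∃ i < F.natDegree, F.coeff i ≠ 0 := by
    by_contra! hzero
    refine hX (hF.as_sum.trans (add_eq_left.mpr (Finset.sum_eq_zero fun i hi => ?_)))
    rw [hzero i (Finset.mem_range.mp hi), C_0, zero_mul]
  obtain ⟨a, b, hb, hdvd, i, hi, hndvd⟩ := exists_newton_slope hne
  have hdeg : (F.map (PowerSeries.expand b hb).toRingHom).natDegree = F.natDegree :=
    hF.natDegree_map _
  obtain ⟨G, hG⟩ := exists_scaleRoots_eq (F := F.map (PowerSeries.expand b hb).toRingHom)
    (s := PowerSeries.X ^ a) fun i hi => by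
      rw [hdeg] at hi ⊢
      rw [← pow_mul, coeff_map]
      exact hdvd i hi
  refine ⟨b, hb, _, G, pow_ne_zero a PowerSeries.X_ne_zero, hG, fun hGX => hndvd ?_⟩
  have hGdeg : G.natDegree = F.natDegree := by rw [← hdeg, ← hG, natDegree_scaleRoots]
  have hGi : PowerSeries.X ∣ G.coeff i := by
    rw [PowerSeries.X_dvd_iff, ← coeff_map, hGX, coeff_X_pow, if_neg (hi.trans_eq hGdeg.symm).ne]
  have hcoeff : PowerSeries.expand b hb (F.coeff i) =
      G.coeff i * (PowerSeries.X ^ a) ^ (F.natDegree - i) := by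
    rw [← hGdeg, ← coeff_scaleRoots, hG, coeff_map]
    rfl
  rw [hcoeff, ← pow_mul, pow_succ']
  exact mul_dvd_mul_right hGi _

theorem exists_monic_dvd_natDegree_lt [IsAlgClosed K] [CharZero K] {G : K⟦X⟧[X]} (hG : G.Monic)
    (hnext : G.nextCoeff = 0) (hX : G.map PowerSeries.constantCoeff ≠ X ^ G.natDegree) :
    ∃ g : K⟦X⟧[X], g.Monic ∧ g ∣ G ∧ g.natDegree ≠ 0 ∧ g.natDegree < G.natDegree := by
  set P := G.map PowerSeries.constantCoeff
  have hP : P.Monic := hG.map _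
  have hPdeg : P.natDegree = G.natDegree := hG.natDegree_map _
  have hPnext : P.nextCoeff = 0 := by
    rw [nextCoeff_eq_zero] at hnext ⊢
    simp only [hPdeg]
    exact hnext.imp_right fun h => ⟨h.1, by rw [coeff_map, h.2, map_zero]⟩
  obtain ⟨e, he, hlt⟩ := exists_isRoot_rootMultiplicity_lt_natDegree hP hPnext (by rwa [hPdeg])
  obtain ⟨g, hg, hgG, hgdeg, -⟩ := exists_monic_dvd_map_constantCoeff_eq hP.ne_zero e
  exact ⟨g, hg, hgG, hgdeg ▸ ((rootMultiplicity_pos hP.ne_zero).mpr he).ne', by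
    rwa [hgdeg, ← hPdeg]⟩

theorem exists_monic_natDegree_lt_of_nextCoeff_eq_zero [IsAlgClosed K] [CharZero K] {F : K⟦X⟧[X]}
    (hF : F.Monic) (hnext : F.nextCoeff = 0) (hX : F ≠ X ^ F.natDegree) :
    ∃ g : K⟦X⟧[X], g.Monic ∧ g.natDegree ≠ 0 ∧ g.natDegree < F.natDegree ∧
      (HasPuiseuxRoot g → HasPuiseuxRoot F) := by
  obtain ⟨b, hb, s, G, hs, hGs, hGX⟩ := exists_map_expand_eq_scaleRoots hF hX
  have hG : G.Monic := by
    rw [← monic_scaleRoots_iff s, hGs]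
    exact hF.map _
  have hGdeg : G.natDegree = F.natDegree := by
    rw [← natDegree_scaleRoots G s, hGs, hF.natDegree_map]
  have hGnext : G.nextCoeff = 0 := by
    have : G.nextCoeff * s = 0 := by
      rw [← nextCoeff_scaleRoots, hGs, nextCoeff_eq_zero, hF.natDegree_map]
      exact (nextCoeff_eq_zero.mp hnext).imp_right fun h => ⟨h.1, by
        rw [coeff_map, h.2, map_zero]⟩
    exact (mul_eq_zero.mp this).resolve_right hs
  obtain ⟨g, hg, hgG, hg0, hglt⟩ := exists_monic_dvd_natDegree_lt hG hGnext hGX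
  exact ⟨g, hg, hg0, hGdeg ▸ hglt, fun h => .of_map_expand (hGs ▸ (h.of_dvd hgG).scaleRoots s)⟩

/-- Translation removes the next-to-leading coefficient. Rescaling along the Newton polygon then
makes the residue polynomial different from `Yⁿ`, hence, in characteristic zero, not an `n`-th power
of a linear factor, and Weierstrass preparation splits off a factor of smaller degree. -/
theorem hasPuiseuxRoot_of_monic [IsAlgClosed K] [CharZero K] {F : K⟦X⟧[X]} (hF : F.Monic)
    (hn : F.natDegree ≠ 0) : HasPuiseuxRoot F := by
  induction hd : F.natDegree using Nat.strong_induction_on generalizing F with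
  | _ n ih =>
  subst hd
  have hunit : IsUnit (F.natDegree : K⟦X⟧) := by
    rw [← map_natCast (PowerSeries.C (R := K))]
    exact (IsUnit.mk0 _ (Nat.cast_ne_zero.mpr hn)).map _
  obtain ⟨c, hc⟩ := exists_nextCoeff_taylor_eq_zero hF hunit
  have hdeg : (taylor c F).natDegree = F.natDegree := natDegree_taylor F c
  apply HasPuiseuxRoot.of_taylor (c := c)
  by_cases hX : taylor c F = X ^ (taylor c F).natDegree
  · exact ⟨1, one_ne_zero, 0, by rw [hX, eval₂_X_pow, zero_pow (hdeg ▸ hn)]⟩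
  · obtain ⟨g, hg, hg0, hglt, hroot⟩ := exists_monic_natDegree_lt_of_nextCoeff_eq_zero
      (by rw [Monic, leadingCoeff_taylor, hF]) hc hX
    exact hroot (ih _ (hdeg ▸ hglt) hg hg0 rfl)

theorem exists_puiseux_root_constantCoeff_eq [IsAlgClosed K] [CharZero K] {F : K⟦X⟧[X]}
    (hF : F.map PowerSeries.constantCoeff ≠ 0) {e : K}
    (he : (F.map PowerSeries.constantCoeff).IsRoot e) :
    ∃ (N : ℕ) (hN : N ≠ 0) (ψ : K⟦X⟧), PowerSeries.constantCoeff ψ = e ∧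
      F.eval₂ (PowerSeries.expand N hN : K⟦X⟧ →ₐ[K] K⟦X⟧).toRingHom ψ = 0 := by
  obtain ⟨g, hg, hgF, hgdeg, hge⟩ := exists_monic_dvd_map_constantCoeff_eq hF e
  obtain ⟨N, hN, ψ, hψ⟩ := hasPuiseuxRoot_of_monic hg
    (hgdeg ▸ ((rootMultiplicity_pos hF).mpr he).ne')
  refine ⟨N, hN, ψ, ?_, eval₂_eq_zero_of_dvd_of_eval₂_eq_zero _ _ hgF hψ⟩
  have hcomp : PowerSeries.constantCoeff.comp
      (PowerSeries.expand N hN : K⟦X⟧ →ₐ[K] K⟦X⟧).toRingHom = PowerSeries.constantCoeff :=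
    RingHom.ext (PowerSeries.constantCoeff_expand N hN)
  have heval : (PowerSeries.constantCoeff ψ - e) ^ g.natDegree = 0 := by
    have := congrArg PowerSeries.constantCoeff hψ
    rw [hom_eval₂, hcomp, ← eval_map, hge, map_zero] at this
    simpa using this
  exact sub_eq_zero.mp (eq_zero_of_pow_eq_zero heval)

end NewtonPuiseux

section HahnSeries

variable {K : Type*} [Field K]

theorem algebraMap_hahnSeries (a : K) : algebraMap K (HahnSeries ℚ K) a = HahnSeries.C a := by
  rw [HahnSeries.algebraMap_apply']
  exact HahnSeries.ofPowerSeries_C a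

theorem orderTop_algebraMap {a : K} (ha : a ≠ 0) :
    (algebraMap K (HahnSeries ℚ K) a).orderTop = 0 := by
  rw [algebraMap_hahnSeries]
  exact HahnSeries.orderTop_single ha

theorem order_inv (x : HahnSeries ℚ K) : x⁻¹.order = -x.order := by
  rcases eq_or_ne x 0 with rfl | hx
  · simp
  · rw [eq_neg_iff_add_eq_zero, ← HahnSeries.order_mul (inv_ne_zero hx) hx, inv_mul_cancel₀ hx,
      HahnSeries.order_one]

theorem deg_pos_iff {φ : HahnSeries ℚ K} : 0 < deg φ ↔ φ.order < 0 := by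
  unfold deg
  split_ifs with h
  · simp [h]
  · rw [← WithBot.coe_zero, WithBot.coe_lt_coe, neg_pos]

theorem order_neg_of_order_sub_nonneg {x y : HahnSeries ℚ K} (h : 0 ≤ (x - y).order)
    (hx : x.order < 0) : y.order < 0 := by
  contrapose! hx
  rw [← HahnSeries.zero_le_orderTop_iff] at h hx ⊢
  rw [← sub_add_cancel x y]
  exact (le_min h hx).trans HahnSeries.min_orderTop_le_orderTop_add

theorem order_neg_iff_of_order_sub_nonneg {x y : HahnSeries ℚ K} (h : 0 ≤ (x - y).order) :
    x.order < 0 ↔ y.order < 0 :=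
  ⟨order_neg_of_order_sub_nonneg h,
    order_neg_of_order_sub_nonneg (by rwa [← neg_sub, HahnSeries.order_neg])⟩

theorem orderTop_aeval_nonneg (q : K[X]) {τ : HahnSeries ℚ K} (hτ : 0 ≤ τ.orderTop) :
    0 ≤ (aeval τ q).orderTop := by
  induction q using Polynomial.induction_on with
  | C a =>
    rcases eq_or_ne a 0 with rfl | ha
    · simp
    · rw [aeval_C, orderTop_algebraMap ha]
  | add p q hp hq =>
    rw [map_add]
    exact (le_min hp hq).trans HahnSeries.min_orderTop_le_orderTop_add
  | monomial n a h =>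
    rw [pow_succ, ← mul_assoc, map_mul, aeval_X, HahnSeries.orderTop_mul]
    exact add_nonneg h hτ

theorem orderTop_aeval_eq_zero {q : K[X]} (hq : q.coeff 0 ≠ 0) {τ : HahnSeries ℚ K}
    (hτ : 0 < τ.orderTop) : (aeval τ q).orderTop = 0 := by
  have hC := orderTop_algebraMap hq
  rw [← divX_mul_X_add q, map_add, map_mul, aeval_X, aeval_C, HahnSeries.orderTop_add_eq_right, hC]
  rw [hC, HahnSeries.orderTop_mul]
  exact hτ.trans_le (le_add_of_nonneg_left (orderTop_aeval_nonneg _ hτ.le))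

theorem ne_zero_of_order_pos {τ : HahnSeries ℚ K} (hτ : 0 < τ.order) : τ ≠ 0 := by
  rintro rfl
  simp at hτ

theorem orderTop_aeval {q : K[X]} (hq : q ≠ 0) {τ : HahnSeries ℚ K} (hτ : 0 < τ.order) :
    (aeval τ q).orderTop = (q.natTrailingDegree * τ.order : ℚ) := by
  have hτ0 := ne_zero_of_order_pos hτ
  obtain ⟨g, hg, hXg⟩ := exists_eq_pow_rootMultiplicity_mul_and_not_dvd q hq 0
  rw [C_0, sub_zero] at hg hXg
  rw [rootMultiplicity_eq_natTrailingDegree'] at hg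
  rw [X_dvd_iff] at hXg
  conv_lhs => rw [hg]
  rw [map_mul, map_pow, aeval_X, HahnSeries.orderTop_mul,
    orderTop_aeval_eq_zero hXg ((HahnSeries.zero_lt_orderTop_iff hτ0).2 hτ), add_zero,
    ← HahnSeries.order_eq_orderTop_of_ne_zero (pow_ne_zero _ hτ0), HahnSeries.order_pow,
    nsmul_eq_mul]

theorem transcendental_of_order_pos {τ : HahnSeries ℚ K} (hτ : 0 < τ.order) :
    Transcendental K τ := by
  rintro ⟨q, hq, h⟩
  exact WithTop.coe_ne_top ((orderTop_aeval hq hτ).symm.trans (by rw [h, HahnSeries.orderTop_zero]))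

theorem order_aeval (q : K[X]) {τ : HahnSeries ℚ K} (hτ : 0 < τ.order) :
    (aeval τ q).order = q.natTrailingDegree * τ.order := by
  rcases eq_or_ne q 0 with rfl | hq
  · simp
  · have hne := (transcendental_iff.1 (transcendental_of_order_pos hτ) q).mt hq
    rw [← WithTop.coe_inj, HahnSeries.order_eq_orderTop_of_ne_zero hne, orderTop_aeval hq hτ]

end HahnSeries

section LocalCoord

variable {K L : Type*} [Field K] [Field L] [Algebra K L]

/-- The point of `ℙ¹` with local parameter `τ` at `s ∈ 𝕂 ∪ {∞}`: it is `s + τ` if `s` is finite,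
and `τ⁻¹` if `s = ∞`. -/
def localCoord (s : OnePoint K) (τ : L) : L :=
  s.elim τ⁻¹ fun a => algebraMap K L a + τ

theorem transcendental_localCoord (s : OnePoint K) {τ : L} (hτ : Transcendental K τ) :
    Transcendental K (localCoord s τ) := by
  induction s with
  | infty => exact fun h => hτ (IsAlgebraic.inv_iff.1 h)
  | coe a => exact fun h => hτ (by simpa [localCoord] using h.sub (isAlgebraic_algebraMap a))

/-- The order of vanishing of a polynomial at `s ∈ 𝕂 ∪ {∞}`, taken to be `0` for `q = 0`. -/
def localOrd (s : OnePoint K) (q : K[X]) : ℤ :=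
  s.elim (-q.natDegree) fun a => q.rootMultiplicity a

theorem order_aeval_inv (q : K[X]) {τ : HahnSeries ℚ K} (hτ : 0 < τ.order) :
    (aeval τ⁻¹ q).order = -q.natDegree * τ.order := by
  rcases eq_or_ne q 0 with rfl | hq
  · simp
  have hτ0 := ne_zero_of_order_pos hτ
  have hrev : aeval τ q.reverse ≠ 0 :=
    (transcendental_iff.1 (transcendental_of_order_pos hτ) _).mt (by simpa using hq)
  let : Invertible τ⁻¹ := invertibleOfNonzero (inv_ne_zero hτ0)
  have h := eval₂_reverse_mul_pow (algebraMap K (HahnSeries ℚ K)) τ⁻¹ q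
  rw [invOf_eq_inv, inv_inv, ← aeval_def, ← aeval_def] at h
  rw [← h, HahnSeries.order_mul hrev (pow_ne_zero _ (inv_ne_zero hτ0)), order_aeval _ hτ,
    natTrailingDegree_reverse, HahnSeries.order_pow, order_inv]
  simp

theorem order_aeval_localCoord (q : K[X]) (s : OnePoint K) {τ : HahnSeries ℚ K}
    (hτ : 0 < τ.order) : (aeval (localCoord s τ) q).order = localOrd s q * τ.order := by
  induction s with
  | infty => simpa [localCoord, localOrd] using order_aeval_inv q hτ
  | coe a =>
    have h : aeval (localCoord (a : OnePoint K) τ) q = aeval τ (taylor a q) := by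
      simp [localCoord, taylor_apply, aeval_comp, add_comm]
    rw [h, order_aeval _ hτ, taylor_apply, ← rootMultiplicity_eq_natTrailingDegree]
    simp [localOrd]

theorem isPole_iff_localOrd (f : RatFunc K) (s : OnePoint K) :
    IsPole f s ↔ localOrd s f.num < localOrd s f.denom := by
  induction s with
  | infty => simp [IsPole, localOrd]
  | coe a =>
    change f.denom.eval a = 0 ↔ (f.num.rootMultiplicity a : ℤ) < f.denom.rootMultiplicity a
    rw [Nat.cast_lt]
    refine ⟨fun hdenom => ?_, fun hlt => (rootMultiplicity_pos f.denom_ne_zero).1 (by lia)⟩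
    have hnum : ¬ f.num.IsRoot a := fun hnum => by
      obtain ⟨u, v, huv⟩ := f.isCoprime_num_denom
      simpa [hnum.eq_zero, hdenom] using congrArg (eval a) huv
    rw [rootMultiplicity_eq_zero hnum]
    exact (rootMultiplicity_pos f.denom_ne_zero).2 hdenom

theorem isPole_iff_order_neg (f : RatFunc K) (s : OnePoint K) {τ : HahnSeries ℚ K}
    (hτ : 0 < τ.order) :
    IsPole f s ↔ (f.eval (algebraMap K (HahnSeries ℚ K)) (localCoord s τ)).order < 0 := by
  rw [isPole_iff_localOrd]
  rcases eq_or_ne f 0 with rfl | hf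
  · induction s <;> simp [localOrd]
  have hne : ∀ q : K[X], q ≠ 0 → aeval (localCoord s τ) q ≠ 0 := fun q =>
    (transcendental_iff.1 (transcendental_localCoord s (transcendental_of_order_pos hτ)) q).mt
  have hnum := hne _ (RatFunc.num_ne_zero hf)
  have hdenom := hne _ f.denom_ne_zero
  rw [RatFunc.eval, ← aeval_def, ← aeval_def, div_eq_mul_inv,
    HahnSeries.order_mul hnum (inv_ne_zero hdenom), order_inv, order_aeval_localCoord _ _ hτ,
    order_aeval_localCoord _ _ hτ, ← sub_eq_add_neg, ← sub_mul, mul_neg_iff]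
  simp [hτ, hτ.not_gt]

theorem finite_isPole (f : RatFunc K) : {s : OnePoint K | IsPole f s}.Finite := by
  refine (((f.denom.rootSet_finite K).image OnePoint.some).insert OnePoint.infty).subset ?_
  intro s hs
  induction s with
  | infty => exact Set.mem_insert _ _
  | coe a =>
    refine Set.mem_insert_of_mem _ ⟨a, mem_rootSet.2 ⟨f.denom_ne_zero, ?_⟩, rfl⟩
    rwa [coe_aeval_eq_eval]

end LocalCoord

section PuiseuxRoot

variable {K : Type*} [Field K]

/-- The embedding `∑ aₘ tᵐ ↦ ∑ aₘ t ^ (m / N)` of Laurent series into Hahn series with rational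
exponents. -/
def puiseuxEmb (N : ℕ) (hN : N ≠ 0) : HahnSeries ℤ K →+* HahnSeries ℚ K :=
  HahnSeries.embDomainRingHom
    ((AddMonoidHom.mulRight (N : ℚ)⁻¹).comp (Int.castAddHom ℚ))
    (fun a b h => by simpa [hN] using h)
    (fun a b => by
      have : (0 : ℚ) < (N : ℚ)⁻¹ := by positivity
      simp [this])

theorem puiseuxEmb_single (N : ℕ) (hN : N ≠ 0) (n : ℤ) (a : K) :
    puiseuxEmb N hN (HahnSeries.single n a) = HahnSeries.single (n * (N : ℚ)⁻¹) a :=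
  HahnSeries.embDomain_single

theorem isPuiseux_puiseuxEmb (N : ℕ) (hN : N ≠ 0) (x : HahnSeries ℤ K) :
    IsPuiseux (puiseuxEmb N hN x) := by
  refine ⟨N, Nat.pos_of_ne_zero hN, fun α hα => ?_⟩
  obtain ⟨m, -, rfl⟩ := HahnSeries.support_embDomain_subset hα
  exact ⟨m, by simp [hN]⟩

theorem orderTop_puiseuxEmb_pos (N : ℕ) (hN : N ≠ 0) {x : HahnSeries ℤ K} (hx : 0 < x.orderTop) :
    0 < (puiseuxEmb N hN x).orderTop := by
  have h : (puiseuxEmb N hN x).orderTop = x.orderTop.map fun m : ℤ => m * (N : ℚ)⁻¹ :=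
    HahnSeries.orderTop_embDomain
  rw [h]
  cases hm : x.orderTop with
  | top => exact WithTop.top_pos
  | coe m =>
    rw [hm, ← WithTop.coe_zero, WithTop.coe_lt_coe] at hx
    rw [WithTop.map_coe, ← WithTop.coe_zero, WithTop.coe_lt_coe]
    positivity

theorem orderTop_ofPowerSeries_pos {R : Type*} [Semiring R] {x : R⟦X⟧}
    (hx : PowerSeries.constantCoeff x = 0) : 0 < (HahnSeries.ofPowerSeries ℤ R x).orderTop := by
  rw [HahnSeries.ofPowerSeries_apply, HahnSeries.orderTop_embDomain]
  cases hm : (HahnSeries.toPowerSeries.symm x).orderTop with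
  | top => exact WithTop.top_pos
  | coe m =>
    have hm0 : m ≠ 0 := by
      rintro rfl
      exact HahnSeries.coeff_orderTop_ne hm (by simpa using hx)
    rw [WithTop.map_coe, ← WithTop.coe_zero, WithTop.coe_lt_coe]
    exact Int.natCast_pos.2 (Nat.pos_of_ne_zero hm0)

theorem aevalAeval_eq_eval₂ {R A : Type*} [CommRing R] [CommRing A] [Algebra R A] (x y : A)
    (P : R[X][X]) : aevalAeval x y P = P.eval₂ (aeval x : R[X] →ₐ[R] A).toRingHom y := by
  induction P using Polynomial.induction_on with
  | C a => rw [aevalAeval_C, eval₂_C]; rfl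
  | add p q hp hq => rw [map_add, eval₂_add, hp, hq]
  | monomial n a h =>
    rw [pow_succ, ← mul_assoc, map_mul, eval₂_mul, h, aevalAeval_Y, eval₂_X]

theorem puiseuxEmb_ofPowerSeries_expand_coe (N : ℕ) (hN : N ≠ 0) (q : K[X]) :
    puiseuxEmb N hN (HahnSeries.ofPowerSeries ℤ K (PowerSeries.expand N hN (q : K⟦X⟧))) =
      aeval (HahnSeries.single (1 : ℚ) (1 : K)) q := by
  induction q using Polynomial.induction_on with
  | C a =>
    have h : PowerSeries.expand N hN (PowerSeries.C a) = PowerSeries.C a :=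
      PowerSeries.expand_C N hN a
    simp [h, algebraMap_hahnSeries, puiseuxEmb_single]
  | add p q hp hq => simp only [coe_add, map_add, hp, hq]
  | monomial n a h =>
    rw [pow_succ, ← mul_assoc, coe_mul, map_mul, map_mul, map_mul, h]
    simp [puiseuxEmb_single, hN]

theorem exists_puiseux_root [IsAlgClosed K] [CharZero K] {P : K[X][X]}
    (h0 : P.evalEval 0 0 = 0) (hP : P.map (evalRingHom 0) ≠ 0) :
    ∃ ψ : HahnSeries ℚ K, IsPuiseux ψ⁻¹ ∧ 0 < ψ.orderTop ∧
      aevalAeval (HahnSeries.single 1 1) ψ P = 0 := by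
  have hcc : (PowerSeries.constantCoeff (R := K)).comp coeToPowerSeries.ringHom =
      evalRingHom 0 := by
    ext <;> simp
  have hmap : (P.map coeToPowerSeries.ringHom).map PowerSeries.constantCoeff =
      P.map (evalRingHom 0) := by
    rw [Polynomial.map_map, hcc]
  obtain ⟨N, hN, ψ, hψ0, hψ⟩ := exists_puiseux_root_constantCoeff_eq (hmap ▸ hP) (e := 0) (by
    rw [hmap, IsRoot.def, map_evalRingHom_eval, h0])
  set E : K⟦X⟧ →+* HahnSeries ℚ K := (puiseuxEmb N hN).comp (HahnSeries.ofPowerSeries ℤ K)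
  refine ⟨E ψ, ?_, orderTop_puiseuxEmb_pos N hN (orderTop_ofPowerSeries_pos hψ0), ?_⟩
  · rw [show (E ψ)⁻¹ = _ from (map_inv₀ (puiseuxEmb N hN) (HahnSeries.ofPowerSeries ℤ K ψ)).symm]
    exact isPuiseux_puiseuxEmb N hN _
  · have hE : (E.comp (PowerSeries.expand N hN : K⟦X⟧ →ₐ[K] K⟦X⟧).toRingHom).comp
        coeToPowerSeries.ringHom =
          (aeval (HahnSeries.single (1 : ℚ) (1 : K)) : K[X] →ₐ[K] HahnSeries ℚ K).toRingHom :=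
      RingHom.ext (puiseuxEmb_ofPowerSeries_expand_coe N hN)
    rw [aevalAeval_eq_eval₂, ← hE, ← eval₂_map, ← hom_eval₂, hψ, map_zero]

end PuiseuxRoot

section Bihomogenization

theorem coeff_coeff_swap {R : Type*} [CommRing R] (p : R[X][X]) (i j : ℕ) :
    ((Bivariate.swap p).coeff i).coeff j = (p.coeff j).coeff i := by
  induction p using Polynomial.induction_on' with
  | add p q hp hq => simp only [map_add, coeff_add, hp, hq]
  | monomial n a =>
    induction a using Polynomial.induction_on' with
    | add a b ha hb => simp only [map_add, coeff_add, ha, hb]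
    | monomial m c =>
      rw [Bivariate.swap_monomial_monomial]
      simp only [coeff_monomial]
      split_ifs <;> simp_all only [coeff_monomial, if_true, if_false, coeff_zero]

variable {K : Type*} [Field K]

theorem degX_swap (p : K[X][X]) : degX (Bivariate.swap p) = degY p := by
  rw [degX, Bivariate.swap_swap_apply, degY]

theorem natDegree_coeff_le_degX (p : K[X][X]) (j : ℕ) : (p.coeff j).natDegree ≤ degX p := by
  refine natDegree_le_iff_coeff_eq_zero.2 fun i hi => ?_
  rw [← coeff_coeff_swap, coeff_eq_zero_of_natDegree_lt hi, coeff_zero]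

theorem aevalAeval_eq_sum {A : Type*} [CommRing A] [Algebra K A] (p : K[X][X]) (x y : A) :
    aevalAeval x y p = ∑ i ∈ Finset.range (degX p + 1), ∑ j ∈ Finset.range (degY p + 1),
      algebraMap K A ((p.coeff j).coeff i) * x ^ i * y ^ j := by
  rw [aevalAeval_eq_eval₂, eval₂_eq_sum_range, Finset.sum_comm]
  refine Finset.sum_congr rfl fun j _ => ?_
  change aeval x (p.coeff j) * y ^ j = _
  simp only [aeval_eq_sum_range' (Nat.lt_succ_of_le (natDegree_coeff_le_degX p j)),
    Finset.sum_mul, Algebra.smul_def]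

section CommRing

variable {A B : Type*} [CommRing A] [Algebra K A] [CommRing B] [Algebra K B]

/-- The bi-homogenization of `p` evaluated in an arbitrary `𝕂`-algebra; over `𝕂` itself this is
`biHomEval`. -/
def biHom (p : K[X][X]) (u v : A × A) : A :=
  ∑ i ∈ Finset.range (degX p + 1), ∑ j ∈ Finset.range (degY p + 1),
    algebraMap K A ((p.coeff j).coeff i) * (u.2 ^ i * u.1 ^ (degX p - i)) *
      (v.2 ^ j * v.1 ^ (degY p - j))

theorem map_biHom (φ : A →ₐ[K] B) (p : K[X][X]) (u v : A × A) :
    φ (biHom p u v) = biHom p (φ u.1, φ u.2) (φ v.1, φ v.2) := by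
  simp only [biHom, map_sum, map_mul, map_pow, AlgHom.commutes]

theorem biHom_swap (p : K[X][X]) (u v : A × A) : biHom (Bivariate.swap p) u v = biHom p v u := by
  have hY : degY (Bivariate.swap p) = degX p := rfl
  rw [biHom, biHom, Finset.sum_comm, degX_swap, hY]
  refine Finset.sum_congr rfl fun i _ => Finset.sum_congr rfl fun j _ => ?_
  rw [coeff_coeff_swap, mul_right_comm]

/-- Homogeneous coordinates of the point of `ℙ¹` with local parameter `t` at `s`; for `t = 0` this
is `homCoord s`. -/
def homLocalCoord (s : OnePoint K) (t : A) : A × A :=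
  s.elim (t, 1) fun a => (1, algebraMap K A a + t)

theorem homLocalCoord_zero (s : OnePoint K) : homLocalCoord s (0 : K) = homCoord s := by
  induction s <;> simp [homLocalCoord, homCoord]

theorem map_homLocalCoord (φ : A →ₐ[K] B) (s : OnePoint K) (t : A) :
    (φ (homLocalCoord s t).1, φ (homLocalCoord s t).2) = homLocalCoord s (φ t) := by
  induction s <;> simp [homLocalCoord]

/-- The left-hand side of the equation of the curve of `p` in terms of the local parameters `x` at
`s₁` and `y` at `s₂`. -/
def localEqn (p : K[X][X]) (s₁ s₂ : OnePoint K) (x y : A) : A :=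
  biHom p (homLocalCoord s₁ x) (homLocalCoord s₂ y)

theorem map_localEqn (φ : A →ₐ[K] B) (p : K[X][X]) (s₁ s₂ : OnePoint K) (x y : A) :
    φ (localEqn p s₁ s₂ x y) = localEqn p s₁ s₂ (φ x) (φ y) := by
  rw [localEqn, map_biHom, map_homLocalCoord, map_homLocalCoord, localEqn]

theorem localEqn_swap (p : K[X][X]) (s₁ s₂ : OnePoint K) (x y : A) :
    localEqn (Bivariate.swap p) s₂ s₁ y x = localEqn p s₁ s₂ x y :=
  biHom_swap p _ _

theorem mem_curve_iff {p : K[X][X]} {s : OnePoint K × OnePoint K} :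
    s ∈ curve p ↔ localEqn p s.1 s.2 (0 : K) 0 = 0 := by
  rw [localEqn, homLocalCoord_zero, homLocalCoord_zero]
  rfl

/-- `localEqn` as a polynomial in the local parameters. -/
def localPoly (p : K[X][X]) (s₁ s₂ : OnePoint K) : K[X][X] := localEqn p s₁ s₂ (C X) X

theorem aevalAeval_localPoly (p : K[X][X]) (s₁ s₂ : OnePoint K) (x y : A) :
    aevalAeval x y (localPoly p s₁ s₂) = localEqn p s₁ s₂ x y := by
  rw [localPoly, map_localEqn, aevalAeval_X, aevalAeval_Y]

end CommRing

section Field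

variable {L : Type*} [Field L] [Algebra K L]

theorem biHom_eq_mul_aevalAeval (p : K[X][X]) {u v : L × L} (hu : u.1 ≠ 0) (hv : v.1 ≠ 0) :
    biHom p u v = u.1 ^ degX p * v.1 ^ degY p * aevalAeval (u.2 / u.1) (v.2 / v.1) p := by
  rw [aevalAeval_eq_sum, biHom, Finset.mul_sum]
  refine Finset.sum_congr rfl fun i hi => ?_
  rw [Finset.mul_sum]
  refine Finset.sum_congr rfl fun j hj => ?_
  rw [Finset.mem_range, Nat.lt_succ_iff] at hi hj
  rw [← pow_mul_pow_sub u.1 hi, ← pow_mul_pow_sub v.1 hj, div_pow, div_pow]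
  field_simp

theorem biHom_infty_left (p : K[X][X]) {v : L × L} (hv : v.1 ≠ 0) :
    biHom p (0, 1) v = v.1 ^ degY p * aeval (v.2 / v.1) (Bivariate.swap p).leadingCoeff := by
  have hdeg : (Bivariate.swap p).leadingCoeff.natDegree < degY p + 1 := by
    rw [← degX_swap]
    exact Nat.lt_succ_of_le (natDegree_coeff_le_degX _ _)
  rw [biHom, Finset.sum_range_succ, Finset.sum_eq_zero, zero_add, aeval_eq_sum_range' hdeg,
    Finset.mul_sum]
  · refine Finset.sum_congr rfl fun j hj => ?_
    rw [Finset.mem_range, Nat.lt_succ_iff] at hj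
    rw [leadingCoeff, coeff_coeff_swap, ← pow_mul_pow_sub v.1 hj, div_pow, Algebra.smul_def, ← degX]
    field_simp
    simp
  · intro i hi
    have : degX p - i ≠ 0 := (Nat.sub_pos_of_lt (Finset.mem_range.1 hi)).ne'
    simp [this]

theorem homLocalCoord_fst_ne_zero (s : OnePoint K) {t : L} (ht : t ≠ 0) :
    (homLocalCoord s t).1 ≠ 0 := by
  induction s <;> simp [homLocalCoord, ht]

theorem homLocalCoord_snd_div_fst (s : OnePoint K) (t : L) :
    (homLocalCoord s t).2 / (homLocalCoord s t).1 = localCoord s t := by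
  induction s <;> simp [homLocalCoord, localCoord]

theorem localEqn_eq_zero_iff {p : K[X][X]} {s₁ s₂ : OnePoint K} {x y : L} (hx : x ≠ 0)
    (hy : y ≠ 0) :
    localEqn p s₁ s₂ x y = 0 ↔ aevalAeval (localCoord s₁ x) (localCoord s₂ y) p = 0 := by
  have hu := homLocalCoord_fst_ne_zero s₁ hx
  have hv := homLocalCoord_fst_ne_zero s₂ hy
  rw [localEqn, biHom_eq_mul_aevalAeval p hu hv, homLocalCoord_snd_div_fst,
    homLocalCoord_snd_div_fst, mul_eq_zero_iff_left]
  exact mul_ne_zero (pow_ne_zero _ hu) (pow_ne_zero _ hv)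

theorem aevalAeval_algebraMap (p : K[X][X]) (a : K) (y : L) :
    aevalAeval (algebraMap K L a) y p = aeval y (p.map (evalRingHom a)) := by
  rw [aevalAeval_eq_eval₂, aeval_def, eval₂_map]
  congr 1
  ext <;> simp

theorem map_evalRingHom_ne_zero {p : K[X][X]} (hp : Irreducible p) (hpx : ∀ q : K[X], p ≠ C q)
    (a : K) : p.map (evalRingHom a) ≠ 0 := by
  intro h
  obtain ⟨q, hq⟩ : C (X - C a) ∣ p := (C_dvd_iff_dvd_coeff _ _).2 fun j =>
    dvd_iff_isRoot.2 (by simpa using congrArg (coeff · j) h)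
  rcases hp.isUnit_or_isUnit hq with hu | hu
  · exact not_isUnit_X_sub_C a (isUnit_C.1 hu)
  · obtain ⟨q, -, rfl⟩ := isUnit_iff.1 hu
    exact hpx _ (hq.trans C_mul.symm)

theorem localEqn_zero_left_ne_zero {p : K[X][X]} (hp : Irreducible p)
    (hpx : ∀ q : K[X], p ≠ C q) (s₁ s₂ : OnePoint K) {y : L} (hy : Transcendental K y) :
    localEqn p s₁ s₂ 0 y ≠ 0 := by
  have hy' := transcendental_iff.1 (transcendental_localCoord s₂ hy)
  have hv := homLocalCoord_fst_ne_zero s₂ (t := y) fun h => hy (h ▸ isAlgebraic_zero)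
  induction s₁ with
  | infty =>
    change biHom p (0, 1) _ ≠ 0
    rw [biHom_infty_left p hv, homLocalCoord_snd_div_fst]
    refine mul_ne_zero (pow_ne_zero _ hv) ((hy' _).mt ?_)
    simpa using hp.ne_zero
  | coe a =>
    rw [localEqn, biHom_eq_mul_aevalAeval p (by simp [homLocalCoord]) hv,
      homLocalCoord_snd_div_fst, homLocalCoord_snd_div_fst]
    refine mul_ne_zero (mul_ne_zero (by simp [homLocalCoord]) (pow_ne_zero _ hv)) ?_
    rw [localCoord, OnePoint.elim_some, add_zero, aevalAeval_algebraMap]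
    exact (hy' _).mt (map_evalRingHom_ne_zero hp hpx a)

theorem localEqn_zero_right_ne_zero {p : K[X][X]} (hp : Irreducible p)
    (hpy : ∀ q : K[X], p ≠ q.map C) (s₁ s₂ : OnePoint K) {x : L} (hx : Transcendental K x) :
    localEqn p s₁ s₂ x 0 ≠ 0 := by
  rw [← localEqn_swap]
  refine localEqn_zero_left_ne_zero ((MulEquiv.irreducible_iff Bivariate.swap).2 hp)
    (fun q h => hpy q ?_) s₂ s₁ hx
  rw [← Bivariate.swap_C, ← h, Bivariate.swap_swap_apply]

end Field

end Bihomogenization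

section PuiseuxPlace

variable {K : Type*} [Field K]

theorem order_single_one_pos : 0 < (HahnSeries.single (1 : ℚ) (1 : K)).order := by
  rw [HahnSeries.order_single one_ne_zero]
  exact one_pos

theorem map_localPoly_ne_zero {p : K[X][X]} (hp : Irreducible p) (hpx : ∀ q : K[X], p ≠ C q)
    (s₁ s₂ : OnePoint K) : (localPoly p s₁ s₂).map (evalRingHom 0) ≠ 0 := by
  intro h
  refine localEqn_zero_left_ne_zero hp hpx s₁ s₂ (RatFunc.transcendental_X (K := K)) ?_
  rw [← aevalAeval_localPoly, ← map_zero (algebraMap K (RatFunc K)), aevalAeval_algebraMap, h,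
    map_zero, map_zero]

theorem exists_puiseux_place [IsAlgClosed K] [CharZero K] {p : K[X][X]} (hp : Irreducible p)
    (hpx : ∀ q : K[X], p ≠ C q) (hpy : ∀ q : K[X], p ≠ q.map C) (s : curve p) :
    ∃ ψ : HahnSeries ℚ K, IsPuiseux ψ⁻¹ ∧ 0 < ψ.order ∧
      aevalAeval (localCoord s.1.1 (HahnSeries.single 1 1)) (localCoord s.1.2 ψ) p = 0 := by
  obtain ⟨ψ, hψ, hpos, h⟩ := exists_puiseux_root
    (by rw [← coe_aevalAeval_eq_evalEval, aevalAeval_localPoly, mem_curve_iff.1 s.2])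
    (map_localPoly_ne_zero hp hpx s.1.1 s.1.2)
  rw [aevalAeval_localPoly] at h
  have hψ0 : ψ ≠ 0 := by
    rintro rfl
    exact localEqn_zero_right_ne_zero hp hpy _ _
      (transcendental_of_order_pos order_single_one_pos) h
  exact ⟨ψ, hψ, (HahnSeries.zero_lt_orderTop_iff hψ0).1 hpos,
    (localEqn_eq_zero_iff (ne_zero_of_order_pos order_single_one_pos) hψ0).1 h⟩

open Classical in
theorem exists_mobius_eq_localCoord {L : Type*} [Field L] [Algebra K L] (s : OnePoint K) :
    ∃ T : GL (Fin 2) K, T • s = OnePoint.infty ∧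
      ∀ z : L, z ≠ 0 → mobius T⁻¹ z = localCoord s z⁻¹ := by
  induction s with
  | infty => exact ⟨1, one_smul _ _, fun z _ => by simp [mobius, localCoord]⟩
  | coe a =>
    -- The inverse of `T` is `z ↦ (a z + 1) / z = a + z⁻¹`.
    refine ⟨(Matrix.GeneralLinearGroup.mkOfDetNeZero !![a, 1; 1, 0] (by simp))⁻¹, ?_, ?_⟩
    · rw [inv_smul_eq_iff, OnePoint.smul_infty_eq_ite]
      simp [Matrix.GeneralLinearGroup.mkOfDetNeZero]
    · intro z hz
      rw [inv_inv]
      simp [mobius, localCoord, Matrix.GeneralLinearGroup.mkOfDetNeZero, add_div, hz]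

end PuiseuxPlace

section EvaluationOnCurve

variable {K L : Type*} [Field K] [Field L] [Algebra K L]

theorem aevalAeval_map_C (x y : L) (q : K[X]) : aevalAeval x y (q.map C) = aeval y q := by
  rw [← Bivariate.swap_C, Bivariate.aevalAeval_swap, aevalAeval_C]

theorem aevalAeval_ne_zero_of_not_dvd {p h : K[X][X]} (hp : Irreducible p)
    (hdeg : p.natDegree ≠ 0) {u v : L} (hu : Transcendental K u) (huv : aevalAeval u v p = 0)
    (hh : ¬ p ∣ h) : aevalAeval u v h ≠ 0 := by
  have hprim := hp.isPrimitive hdeg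
  have hp' := (hprim.irreducible_iff_irreducible_map_fraction_map (K := FractionRing K[X])).1 hp
  have hh' : ¬ p.map (algebraMap K[X] (FractionRing K[X])) ∣ h.map (algebraMap _ _) :=
    fun H => hh (hprim.dvd_of_fraction_map_dvd_fraction_map H)
  obtain ⟨a, b, hab⟩ := hp'.coprime_iff_not_dvd.2 hh'
  have hinj : Function.Injective (aeval u : K[X] →ₐ[K] L).toRingHom :=
    transcendental_iff_injective.1 hu
  let ι : FractionRing K[X] →+* L := IsFractionRing.lift hinj
  have hι : ι.comp (algebraMap K[X] (FractionRing K[X])) = (aeval u : K[X] →ₐ[K] L).toRingHom :=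
    RingHom.ext (IsFractionRing.lift_algebraMap hinj)
  have hbezout := congrArg (eval₂ ι v) hab
  rw [eval₂_add, eval₂_mul, eval₂_mul, eval₂_map, eval₂_map, hι, ← aevalAeval_eq_eval₂,
    ← aevalAeval_eq_eval₂, huv, mul_zero, zero_add, eval₂_one] at hbezout
  exact right_ne_zero_of_mul_eq_one hbezout

theorem algebraMap_num₂_div_den₂ (r : RatFunc₂ K) :
    algebraMap K[X][X] (RatFunc₂ K) (num₂ r) / algebraMap K[X][X] (RatFunc₂ K) (den₂ r) = r := by
  rw [num₂, den₂, ← IsFractionRing.mk'_eq_div, IsFractionRing.mk'_num_den]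

theorem den₂_ne_zero (r : RatFunc₂ K) : den₂ r ≠ 0 :=
  nonZeroDivisors.coe_ne_zero _

theorem algebraMap_ratFunc₂_ne_zero {b : K[X][X]} (hb : b ≠ 0) :
    algebraMap K[X][X] (RatFunc₂ K) b ≠ 0 :=
  (map_ne_zero_iff _ (IsFractionRing.injective _ _)).2 hb

theorem evalRat_eq_div {a b : K[X][X]} {u v : L} (hb : aevalAeval u v b ≠ 0) :
    evalRat u v (algebraMap K[X][X] (RatFunc₂ K) a / algebraMap K[X][X] (RatFunc₂ K) b) =
      aevalAeval u v a / aevalAeval u v b := by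
  set r := algebraMap K[X][X] (RatFunc₂ K) a / algebraMap K[X][X] (RatFunc₂ K) b with hr
  have hcross : num₂ r * b = a * den₂ r := by
    have hb0 : b ≠ 0 := fun h => hb (by rw [h, map_zero])
    rw [← algebraMap_num₂_div_den₂ r, div_eq_div_iff (algebraMap_ratFunc₂_ne_zero (den₂_ne_zero r))
      (algebraMap_ratFunc₂_ne_zero hb0), ← map_mul, ← map_mul] at hr
    exact IsFractionRing.injective K[X][X] (RatFunc₂ K) hr
  have hden : den₂ r ∣ b :=
    (IsFractionRing.num_den_reduced K[X][X] r).symm.dvd_of_dvd_mul_left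
      ⟨a, hcross.trans (mul_comm _ _)⟩
  have hden' : aevalAeval u v (den₂ r) ≠ 0 := ne_zero_of_dvd_ne_zero hb (map_dvd _ hden)
  rw [evalRat, div_eq_div_iff hden' hb, ← map_mul, ← map_mul, hcross]

theorem inX_eq (f : RatFunc K) : inX f = algebraMap K[X][X] (RatFunc₂ K) (C f.num) /
    algebraMap K[X][X] (RatFunc₂ K) (C f.denom) := by
  have h (q : K[X]) : aeval (algebraMap K[X][X] (RatFunc₂ K) (C X)) q =
      algebraMap K[X][X] (RatFunc₂ K) (C q) := by
    rw [aeval_algebraMap_apply, ← algebraMap_eq, aeval_algebraMap_apply, aeval_X_left_apply]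
  rw [inX, RatFunc.eval, ← aeval_def, ← aeval_def, h, h]

theorem inY_eq (g : RatFunc K) : inY g = algebraMap K[X][X] (RatFunc₂ K) (g.num.map C) /
    algebraMap K[X][X] (RatFunc₂ K) (g.denom.map C) := by
  have h (q : K[X]) : aeval (algebraMap K[X][X] (RatFunc₂ K) X) q =
      algebraMap K[X][X] (RatFunc₂ K) (q.map C) := by
    rw [aeval_algebraMap_apply]
    rfl
  rw [inY, RatFunc.eval, ← aeval_def, ← aeval_def, h, h]

theorem eval_sub_eval_eq_evalRat {K L : Type u} [Field K] [Field L] [Algebra K L] {p : K[X][X]}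
    (hp : Irreducible p) (hdeg : p.natDegree ≠ 0) {r : RatFunc₂ K} {f g : RatFunc K}
    (hfg : (f, g) ∈ separatedPairs r p) {u v : L} (hu : Transcendental K u)
    (hv : Transcendental K v) (huv : aevalAeval u v p = 0) :
    f.eval (algebraMap K L) u - g.eval (algebraMap K L) v = evalRat u v r := by
  obtain ⟨_, ⟨q, hq, rfl⟩, hrq⟩ := hfg
  have hr : r = algebraMap K[X][X] (RatFunc₂ K) ((C f.num * g.denom.map C -
        g.num.map C * C f.denom) * den₂ q - num₂ q * p * (C f.denom * g.denom.map C)) /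
      algebraMap K[X][X] (RatFunc₂ K) (C f.denom * g.denom.map C * den₂ q) := by
    have hf := algebraMap_ratFunc₂_ne_zero (C_ne_zero.2 f.denom_ne_zero)
    have hg := algebraMap_ratFunc₂_ne_zero
      ((Polynomial.map_ne_zero_iff C_injective).2 g.denom_ne_zero)
    have hden := algebraMap_ratFunc₂_ne_zero (den₂_ne_zero q)
    have hnum := (div_eq_iff hden).1 (algebraMap_num₂_div_den₂ q)
    rw [eq_sub_of_add_eq hrq.symm, inX_eq, inY_eq]
    simp only [map_mul, map_sub, hnum]
    field_simp
  have hfu : aeval u f.denom ≠ 0 := (transcendental_iff.1 hu _).mt f.denom_ne_zero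
  have hgv : aeval v g.denom ≠ 0 := (transcendental_iff.1 hv _).mt g.denom_ne_zero
  have hquv : aevalAeval u v (den₂ q) ≠ 0 := aevalAeval_ne_zero_of_not_dvd hp hdeg hu huv hq
  rw [hr, evalRat_eq_div (by simp only [map_mul, aevalAeval_C, aevalAeval_map_C]; positivity)]
  simp only [RatFunc.eval, ← aeval_def, map_mul, map_sub, aevalAeval_C, aevalAeval_map_C, huv]
  field_simp
  ring

end EvaluationOnCurve

section Orbit

variable {K : Type*} [Field K]

theorem isCurvePole_of_order_neg {p : K[X][X]} {r : RatFunc₂ K} {s : curve p}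
    {ψ : HahnSeries ℚ K} (hψ : IsPuiseux ψ⁻¹) (hpos : 0 < ψ.order)
    (hp : aevalAeval (localCoord s.1.1 (HahnSeries.single 1 1)) (localCoord s.1.2 ψ) p = 0)
    (hr : (evalRat (localCoord s.1.1 (HahnSeries.single 1 1)) (localCoord s.1.2 ψ) r).order < 0) :
    IsCurvePole p r s := by
  obtain ⟨T₁, hT₁, hx⟩ := exists_mobius_eq_localCoord (L := HahnSeries ℚ K) s.1.1
  obtain ⟨T₂, hT₂, hy⟩ := exists_mobius_eq_localCoord (L := HahnSeries ℚ K) s.1.2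
  have hX : (seriesX : HahnSeries ℚ K)⁻¹ = HahnSeries.single 1 1 := by
    rw [seriesX, HahnSeries.inv_single, neg_neg, inv_one]
  refine ⟨T₁, T₂, hT₁, hT₂, ψ⁻¹, hψ, ?_, ?_⟩
  · rwa [deg_pos_iff, order_inv, neg_lt_zero]
  · rw [hx seriesX (HahnSeries.single_ne_zero one_ne_zero), hX,
      hy _ (inv_ne_zero (ne_zero_of_order_pos hpos)), inv_inv, deg_pos_iff]
    exact ⟨hp, hr⟩

theorem isPole_iff_of_not_isCurvePole [IsAlgClosed K] [CharZero K] {p : K[X][X]}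
    (hp : Irreducible p) (hpx : ∀ q : K[X], p ≠ C q) (hpy : ∀ q : K[X], p ≠ q.map C)
    {r : RatFunc₂ K} {f g : RatFunc K} (hfg : (f, g) ∈ separatedPairs r p) {s : curve p}
    (hs : ¬ IsCurvePole p r s) : IsPole f s.1.1 ↔ IsPole g s.1.2 := by
  obtain ⟨ψ, hψ, hpos, hpψ⟩ := exists_puiseux_place hp hpx hpy s
  have hdeg : p.natDegree ≠ 0 := fun h => hpx _ (eq_C_of_natDegree_eq_zero h)
  have hsub := eval_sub_eval_eq_evalRat hp hdeg hfg
    (transcendental_localCoord s.1.1 (transcendental_of_order_pos order_single_one_pos))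
    (transcendental_localCoord s.1.2 (transcendental_of_order_pos hpos)) hpψ
  rw [isPole_iff_order_neg f _ order_single_one_pos, isPole_iff_order_neg g _ hpos]
  refine order_neg_iff_of_order_sub_nonneg (le_of_not_gt fun hlt => hs ?_)
  exact isCurvePole_of_order_neg hψ hpos hpψ (hsub ▸ hlt)

theorem forall_mem_orbit_fst {p : K[X][X]} {s : curve p} {P Q : OnePoint K → Prop}
    (hPQ : ∀ t ∈ orbit p s, (P t.1.1 ↔ Q t.1.2)) {t : curve p} (ht : t ∈ orbit p s)
    (hP : P t.1.1) : ∀ t' ∈ orbit p s, P t'.1.1 := by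
  have hinv (a b : curve p) (hab : a.1.1 = b.1.1 ∨ a.1.2 = b.1.2) :
      (a ∈ orbit p s ∧ P a.1.1) = (b ∈ orbit p s ∧ P b.1.1) := by
    have hmem : a ∈ orbit p s ↔ b ∈ orbit p s :=
      ⟨fun h => h.trans _ _ _ (.rel _ _ hab), fun h => h.trans _ _ _ (.symm _ _ (.rel _ _ hab))⟩
    refine propext ((and_congr_right fun ha => ?_).trans (and_congr_left' hmem))
    rcases hab with h | h
    · rw [h]
    · rw [hPQ a ha, hPQ b (hmem.1 ha), h]
  intro t' ht'
  have htt' := Quot.eqvGen_sound ((ht.symm _ _).trans _ _ _ ht')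
  exact ((congrArg (Quot.lift _ hinv) htt').mp ⟨ht, hP⟩).2

theorem finite_setOf_isPole_and_isPole (p : K[X][X]) (f g : RatFunc K) :
    {t : curve p | IsPole f t.1.1 ∧ IsPole g t.1.2}.Finite :=
  ((finite_isPole f).prod (finite_isPole g)).preimage Subtype.val_injective.injOn

end Orbit

end

end SeparatedVariables

open SeparatedVariables in
theorem mainTheorem5 {K : Type*} [Field K] [IsAlgClosed K] [CharZero K]
    (p : Polynomial (Polynomial K)) (hp : Irreducible p)
    (hpx : ∀ a : Polynomial K, p ≠ Polynomial.C a)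
    (hpy : ∀ b : Polynomial K, p ≠ b.map Polynomial.C)
    (r : SeparatedVariables.RatFunc₂ K) (hr : r ∈ SeparatedVariables.localRing p)
    (f g : RatFunc K) (hfg : (f, g) ∈ SeparatedVariables.separatedPairs r p)
    (s : SeparatedVariables.curve p) (hinf : (SeparatedVariables.orbit p s).Infinite)
    (hpole : ∃ t ∈ SeparatedVariables.orbit p s,
      SeparatedVariables.IsPole f t.1.1 ∨ SeparatedVariables.IsPole g t.1.2) :
    ∃ t ∈ SeparatedVariables.orbit p s, SeparatedVariables.IsCurvePole p r t := by
  by_contra! hno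
  have hiff : ∀ t ∈ orbit p s, (IsPole f t.1.1 ↔ IsPole g t.1.2) := fun t ht =>
    isPole_iff_of_not_isCurvePole hp hpx hpy hfg (hno t ht)
  obtain ⟨t, ht, hpole⟩ := hpole
  have hf : ∀ t ∈ orbit p s, IsPole f t.1.1 :=
    forall_mem_orbit_fst hiff ht (hpole.elim id (hiff t ht).2)
  exact hinf ((finite_setOf_isPole_and_isPole p f g).subset fun t ht =>
    ⟨hf t ht, (hiff t ht).1 (hf t ht)⟩)
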